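/- **Definitions.** A pair $(\mathcal K,U)$ is an *accessible category with concrete directed colimits* if $\mathcal K$ is an accessible category with all small directed colimits and $U:\mathcal K\to\mathbf{Set}$ is a faithful functor preserving directed colimits. It is *coherent* if, whenever $h:A\to C$ and $g:B\to C$ are morphisms of $\mathcal K$ and $f:UA\to UB$ is a map with $U(g)\circ f=U(h)$, there is $\bar f:A\to B$ with $U(\bar f)=f$. It has *concrete monomorphisms* if every morphism of $\mathcal K$ is a monomorphism and $U$ sends it to a monomorphism. For such a pair let $\Sigma_{\mathcal K}$ be the relational signature whose $n$-ary symbols ($n$ finite) are the subfunctors $R$ of $U^n=\mathbf{Set}(n,U-)$ such that $(Uf)^n(a)\in R_B$ implies $a\in R_A$ for every $f:A\to B$ in $\mathcal K$, and let $E:\mathcal K\to\mathbf{Emb}(\Sigma_{\mathcal K})$ be the canonical functor to $\Sigma_{\mathcal K}$-structures and embeddings. The pair is *iso-full* if every isomorphism $EA\to EB$ is $E\bar f$ for some isomorphism $\bar f:A\to B$, and *replete* if whenever $EA\cong X$ there is $B\cong A$ with $EB=X$. A coherent accessible category with concrete directed colimits and concrete monomorphisms is an *abstract elementary class* (AEC)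 if it is iso-full and replete. Let $\mathbf{Acc}$ be the 2-category of accessible categories, accessible functors and natural transformations. Let $\mathbf{Acc}_3$ be the 2-category whose objects are the coherent accessible categories $(\mathcal K,U)$ with concrete directed colimits and concrete monomorphisms such that $\mathcal K$ is equivalent, as a category, to an AEC, whose morphisms are all functors preserving directed colimits, and whose 2-cells are all natural transformations. **Proposition 2.7.** $\mathbf{Acc}_3$ is closed in $\mathbf{Acc}$ under products and equifiers. That is: 1. *Products.* Let $(\mathcal K_i,U_i)_{i\in I}$ be a family of objects of $\mathbf{Acc}_3$ indexed by a set $I$, and let $U:\prod_i\mathcal K_i\to\mathbf{Set}$ be $U\big((A_i)_i\big)=\coprod_i U_iA_i$. Then $(\prod_i\mathcal K_i,U)$ is an object of $\mathbf{Acc}_3$, and with the usual projections $\prod_i\mathcal K_i$ is the product of the $\mathcal K_i$ in $\mathbf{CAT}$, in $\mathbf{Acc}$ and in $\mathbf{Acc}_3$ (strict 2-categorical products). Moreover, if every $(\mathcal K_i,U_i)$ is iso-full, then the coproducts $R=\coprod_iR_i$ of symbols $R_i\in\Sigma_{\mathcal K_i}$ of a common arity $n$ (that is, $R_{(A_i)_i}\subseteq(\coprod_iU_iA_i)^n$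 is the union over $i$ of the images of $(R_i)_{A_i}$) belong to $\Sigma_{\prod_i\mathcal K_i}$ and detect isomorphisms: each bijection $f:U((A_i)_i)\to U((B_i)_i)$ such that $a\in R_{(A_i)_i}\Leftrightarrow f^n(a)\in R_{(B_i)_i}$ for all such $R$ and all $a$ underlies an isomorphism $(A_i)_i\cong(B_i)_i$. Hence $(\prod_i\mathcal K_i,U)$ is again iso-full, and it is equivalent to an AEC $(\mathcal L,V)$ by an equivalence $e:\prod_i\mathcal K_i\to\mathcal L$ with $Ve\cong U$. 2. *Equifiers.* Let $F,G:\mathcal K\to\mathcal L$ be morphisms of $\mathbf{Acc}_3$, where $(\mathcal K,U)$ is the domain, let $\varphi,\psi:F\to G$ be natural transformations, and let $P:\mathrm{Eq}(\varphi,\psi)\to\mathcal K$ be the inclusion of the full subcategory of all $K$ with $\varphi_K=\psi_K$. Then $(\mathrm{Eq}(\varphi,\psi),UP)$ is an object of $\mathbf{Acc}_3$, and with $P$ it is the equifier of $\varphi$ and $\psi$ in $\mathbf{CAT}$, in $\mathbf{Acc}$ and in $\mathbf{Acc}_3$ (strict 2-categorical equifiers). Moreover, if $(\mathcal K,U)$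 is iso-full, then so is $(\mathrm{Eq}(\varphi,\psi),UP)$, and if $(\mathcal K,U)$ is an AEC, then so is $(\mathrm{Eq}(\varphi,\psi),UP)$. -/

import Mathlib

open CategoryTheory CategoryTheory.Limits

universe w

/-! Sets are the types in `Type w`; classes are the types in `Type (w + 1)`.  A locally small category
is a `K : Type (w + 1)` with `[Category.{w} K]`, and `Set` is the category `Type w`. -/

namespace AECat

/-! ### Accessible categories with concrete directed colimits -/

section Hierarchy

variable {K : Type (w + 1)} [Category.{w} K]

/-- Accessible categories with (small) directed colimits.  As usual, small directed colimits are
expressed through small filtered colimits. -/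
structure IsAcc0 (K : Type (w + 1)) [Category.{w} K] : Prop where
  accessible : IsAccessibleCategory.{w} K
  hasDirectedColimits : HasFilteredColimitsOfSize.{w, w} K

/-- `(K, U)` is an accessible category with concrete directed colimits. -/
structure IsAcc1 (U : K ⥤ Type w) : Prop extends IsAcc0 K where
  faithful : U.Faithful
  preserves : PreservesFilteredColimitsOfSize.{w, w} U

/-- Coherence of `(K, U)`: a map `f : U A → U B` with `U g ∘ f = U h` for some `g : B ⟶ C` and
`h : A ⟶ C` underlies a morphism `A ⟶ B`. -/
def IsCoherent (U : K ⥤ Type w) : Prop :=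
  ∀ ⦃A B C : K⦄ (h : A ⟶ C) (g : B ⟶ C) (f : U.obj A ⟶ U.obj B),
    f ≫ U.map g = U.map h → ∃ fbar : A ⟶ B, U.map fbar = f

/-- Every morphism of `K` is a monomorphism, and `U` preserves it as a monomorphism. -/
structure ConcreteMonos (U : K ⥤ Type w) : Prop where
  mono : ∀ ⦃A B : K⦄ (f : A ⟶ B), Mono f
  mono_map : ∀ ⦃A B : K⦄ (f : A ⟶ B), Mono (U.map f)

/-- `(K, U)` is a coherent accessible category with concrete directed colimits and concrete
monomorphisms. -/
structure IsAcc2 (U : K ⥤ Type w) : Prop extends IsAcc1 U where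
  coherent : IsCoherent U
  concreteMonos : ConcreteMonos U

/-! ### Interpretable relation symbols and the functor to structures -/

/-- An element of `Σ_K` of arity `n`: a subfunctor `R` of `U ^ n = Set(n, U -)` for which the morphisms
of `K` behave as embeddings. -/
@[ext]
structure RelSymbol (U : K ⥤ Type w) (n : ℕ) where
  rel : ∀ A : K, Set (Fin n → U.obj A)
  map_mem : ∀ {A B : K} (f : A ⟶ B) (a : Fin n → U.obj A), a ∈ rel A → (U.map f ∘ a) ∈ rel B
  mem_of_map : ∀ {A B : K} (f : A ⟶ B) (a : Fin n → U.obj A), (U.map f ∘ a) ∈ rel B → a ∈ rel A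

/-- The finitary relational signature `Σ_K`. -/
def sig (U : K ⥤ Type w) : FirstOrder.Language.{0, w + 1} where
  Functions := fun _ => Empty
  Relations := fun n => RelSymbol U n

end Hierarchy

/-- `Emb(S)`: structures for the signature `S` on sets, with embeddings as morphisms. -/
structure Emb (S : FirstOrder.Language.{0, w + 1}) : Type (w + 1) where
  carrier : Type w
  [str : S.Structure carrier]

attribute [instance] Emb.str

instance (S : FirstOrder.Language.{0, w + 1}) : Category.{w} (Emb S) where
  Hom X Y := FirstOrder.Language.Embedding S X.carrier Y.carrier
  id X := FirstOrder.Language.Embedding.refl S X.carrier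
  comp f g := g.comp f

theorem Emb.hom_ext {S : FirstOrder.Language.{0, w + 1}} {X Y : Emb S} (f g : X ⟶ Y)
    (h : ∀ x, FirstOrder.Language.Embedding.toEmbedding f x =
      FirstOrder.Language.Embedding.toEmbedding g x) : f = g :=
  FirstOrder.Language.Embedding.ext h

section Hierarchy

variable {K : Type (w + 1)} [Category.{w} K]

/-- The canonical `Σ_K`-structure on `U A`. -/
@[reducible]
def structureOn (U : K ⥤ Type w) (A : K) : (sig U).Structure (U.obj A) where
  funMap := fun f => Empty.elim f
  RelMap := fun R a => a ∈ RelSymbol.rel R A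

/-- The functor `E : K ⥤ Emb(Σ_K)`. -/
def E (U : K ⥤ Type w) (hU : ConcreteMonos U) : K ⥤ Emb (sig U) where
  obj A := { carrier := U.obj A, str := structureOn U A }
  map {A B} f :=
    letI := structureOn U A
    letI := structureOn U B
    { toFun := U.map f
      inj' := (mono_iff_injective _).1 (hU.mono_map f)
      map_fun' := fun g => Empty.elim g
      map_rel' := fun R a => ⟨R.mem_of_map f a, R.map_mem f a⟩ }
  map_id A := by
    refine Emb.hom_ext _ _ fun x => ?_
    change U.map (𝟙 A) x = x
    simp
  map_comp f g := by
    refine Emb.hom_ext _ _ fun x => ?_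
    change U.map (f ≫ g) x = U.map g (U.map f x)
    simp

/-- `E` is full with respect to isomorphisms. -/
def IsoFull (U : K ⥤ Type w) (hU : ConcreteMonos U) : Prop :=
  ∀ ⦃A B : K⦄ (f : (E U hU).obj A ≅ (E U hU).obj B), ∃ fbar : A ≅ B, (E U hU).mapIso fbar = f

/-- `E` is replete. -/
def IsReplete (U : K ⥤ Type w) (hU : ConcreteMonos U) : Prop :=
  ∀ (A : K) (X : Emb (sig U)), Nonempty ((E U hU).obj A ≅ X) →
    ∃ B : K, Nonempty (A ≅ B) ∧ (E U hU).obj B = X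

/-- A set `S` of interpretable relation symbols detects isomorphisms: a bijection `U A → U B` carrying
`R A` onto `R B` for each `R` in `S` underlies an isomorphism `A ≅ B`. -/
def DetectsIsos (U : K ⥤ Type w) (S : ∀ n, Set (RelSymbol U n)) : Prop :=
  ∀ ⦃A B : K⦄ (f : U.obj A ≃ U.obj B),
    (∀ (n : ℕ), ∀ R ∈ S n, ∀ a : Fin n → U.obj A, a ∈ R.rel A ↔ (f ∘ a) ∈ R.rel B) →
      ∃ fbar : A ≅ B, ∀ x, U.map fbar.hom x = f x

/-- `(K, U)` is an abstract elementary class. -/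
structure IsAEC (U : K ⥤ Type w) : Prop extends IsAcc2 U where
  isoFull : IsoFull U concreteMonos
  replete : IsReplete U concreteMonos

/-- `(K, U)` is an object of `Acc₃`: it is an object of `Acc₂`, and `K` is equivalent to an abstract
elementary class. -/
structure IsAcc3 (U : K ⥤ Type w) : Prop extends IsAcc2 U where
  equivAEC : ∃ (L : Type (w + 1)) (_ : Category.{w} L) (V : L ⥤ Type w),
    IsAEC V ∧ Nonempty (K ≌ L)

/-- `(K, U)` is equivalent to an abstract elementary class by an equivalence that respects the
underlying sets up to natural isomorphism. -/
def IsConcretelyEquivAEC (U : K ⥤ Type w) : Prop :=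
  ∃ (L : Type (w + 1)) (_ : Category.{w} L) (V : L ⥤ Type w) (e : K ≌ L),
    IsAEC V ∧ Nonempty (e.functor ⋙ V ≅ U)

end Hierarchy

/-! ### 2-categories over `CAT`, and products and equifiers in them -/

/-- A 2-category of categories (possibly with additional structure), some of the functors between
them, and all natural transformations between these functors. -/
structure TwoCat : Type (w + 3) where
  Obj : Type (w + 2)
  cat : Obj → Cat.{w, w + 1}
  IsMor : ∀ {X Y : Obj}, (cat X ⥤ cat Y) → Prop
  id_isMor : ∀ X : Obj, IsMor (𝟭 (cat X))
  comp_isMor : ∀ {X Y Z : Obj} (F : cat X ⥤ cat Y) (G : cat Y ⥤ cat Z),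
    IsMor F → IsMor G → IsMor (F ⋙ G)

namespace TwoCat

variable (T : TwoCat.{w})

/-- `P` with the projections `π` is the (strict) product of the `K i` in the 2-category `T`; the last
field is the 2-dimensional universal property. -/
structure IsProduct {I : Type w} (K : I → T.Obj) (P : T.Obj)
    (π : ∀ i, T.cat P ⥤ T.cat (K i)) : Prop where
  isMor : ∀ i, T.IsMor (π i)
  lift : ∀ (H : T.Obj) (Q : ∀ i, T.cat H ⥤ T.cat (K i)), (∀ i, T.IsMor (Q i)) →
    ∃! Qbar : T.cat H ⥤ T.cat P, T.IsMor Qbar ∧ ∀ i, Qbar ⋙ π i = Q i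
  lift₂ : ∀ (H : T.Obj) (Q Q' : T.cat H ⥤ T.cat P), T.IsMor Q → T.IsMor Q' →
    ∀ α : ∀ i, Q ⋙ π i ⟶ Q' ⋙ π i, ∃! β : Q ⟶ Q', ∀ i, Functor.whiskerRight β (π i) = α i

/-- `P` with `p` is the (strict) equifier of `φ` and `ψ` in the 2-category `T`; the last field is the
2-dimensional universal property. -/
structure IsEquifier {K L : T.Obj} {F G : T.cat K ⥤ T.cat L} (φ ψ : F ⟶ G)
    (P : T.Obj) (p : T.cat P ⥤ T.cat K) : Prop where
  isMor : T.IsMor p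
  equifies : Functor.whiskerLeft p φ = Functor.whiskerLeft p ψ
  lift : ∀ (X : T.Obj) (H : T.cat X ⥤ T.cat K), T.IsMor H →
    Functor.whiskerLeft H φ = Functor.whiskerLeft H ψ →
      ∃! Hbar : T.cat X ⥤ T.cat P, T.IsMor Hbar ∧ Hbar ⋙ p = H
  lift₂ : ∀ (X : T.Obj) (H H' : T.cat X ⥤ T.cat P), T.IsMor H → T.IsMor H' →
    ∀ α : H ⋙ p ⟶ H' ⋙ p, ∃! β : H ⟶ H', Functor.whiskerRight β p = α

end TwoCat

/-- The 2-category of all locally small categories and all functors. -/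
def CATTwoCat : TwoCat.{w} where
  Obj := Cat.{w, w + 1}
  cat X := X
  IsMor _ := True
  id_isMor _ := trivial
  comp_isMor _ _ _ _ := trivial

/-- Objects of `Acc`: accessible categories. -/
structure AccObj : Type (w + 2) where
  carrier : Type (w + 1)
  [cat : Category.{w} carrier]
  accessible : IsAccessibleCategory.{w} carrier

attribute [instance] AccObj.cat

/-- The 2-category `Acc` of accessible categories and accessible functors. -/
def AccTwoCat : TwoCat.{w} where
  Obj := AccObj.{w}
  cat X := Cat.of X.carrier
  IsMor F := Functor.IsAccessible.{w} F
  id_isMor X :=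
    ⟨Cardinal.aleph0, Cardinal.fact_isRegular_aleph0,
      letI := Cardinal.fact_isRegular_aleph0; inferInstance⟩
  comp_isMor F G hF hG := by
    have := hF
    have := hG
    infer_instance

/-- Objects of `Acc₃`: coherent accessible categories `(K, U)` with concrete directed colimits and
concrete monomorphisms such that `K` is equivalent to an abstract elementary class. -/
structure Acc3Obj : Type (w + 2) where
  carrier : Type (w + 1)
  [cat : Category.{w} carrier]
  U : carrier ⥤ Type w
  isAcc3 : IsAcc3 U

attribute [instance] Acc3Obj.cat

/-- The 2-category `Acc₃`; its morphisms are the functors preserving directed colimits. -/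
def Acc3TwoCat : TwoCat.{w} where
  Obj := Acc3Obj.{w}
  cat X := Cat.of X.carrier
  IsMor F := PreservesFilteredColimitsOfSize.{w, w} F
  id_isMor X := inferInstance
  comp_isMor F G hF hG := by
    have := hF
    have := hG
    exact comp_preservesFilteredColimits F G

/-- The underlying accessible category of an object of `Acc₃`. -/
def Acc3Obj.toAcc (X : Acc3Obj.{w}) : AccObj.{w} where
  carrier := X.carrier
  accessible := X.isAcc3.accessible

/-- The underlying category of an object of `Acc₃`. -/
def Acc3Obj.toCAT (X : Acc3Obj.{w}) : Cat.{w, w + 1} := Cat.of X.carrier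

/-! ### The product and the equifier of categories -/

section Product

variable {I : Type w} {K : I → Type (w + 1)} [∀ i, Category.{w} (K i)]

/-- The functor `∏ K i ⥤ Set` sending `(A i)` to the coproduct of the sets `U i (A i)`. -/
def coprodU (U : ∀ i, K i ⥤ Type w) : (∀ i, K i) ⥤ Type w where
  obj A := Σ i, (U i).obj (A i)
  map {A B} f := TypeCat.ofHom fun x => (⟨x.1, (U x.1).map (f x.1) x.2⟩ : Σ i, (U i).obj (B i))
  map_id A := by
    apply ConcreteCategory.hom_ext
    intro x
    exact Sigma.ext rfl (heq_of_eq (by simp))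
  map_comp f g := by
    apply ConcreteCategory.hom_ext
    intro x
    exact Sigma.ext rfl (heq_of_eq (by simp))

/-- The coproduct of interpretable relation symbols `R i`, all of arity `n`: the tuples that lie in a
single summand `U i (A i)` and belong to `R i` there.  For `n = 0` this is the union in the one-element
set `U ^ 0` of the images of the `R i`. -/
def coprodSymbol (U : ∀ i, K i ⥤ Type w) {n : ℕ} (R : ∀ i, RelSymbol (U i) n) :
    RelSymbol (coprodU U) n where
  rel A := {a | ∃ (i : I) (b : Fin n → (U i).obj (A i)),
    b ∈ (R i).rel (A i) ∧ a = fun k => ⟨i, b k⟩}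
  map_mem := by
    rintro A B f a ⟨i, b, hb, rfl⟩
    exact ⟨i, (U i).map (f i) ∘ b, (R i).map_mem (f i) b hb, rfl⟩
  mem_of_map := by
    rintro A B f a ⟨i, b, hb, hab⟩
    have key : ∀ k, ∃ c : (U i).obj (A i), a k = ⟨i, c⟩ ∧ (U i).map (f i) c = b k := by
      intro k
      have hk : (⟨(a k).1, (U (a k).1).map (f (a k).1) (a k).2⟩ : Σ i, (U i).obj (B i)) =
        ⟨i, b k⟩ := congrFun hab k
      generalize a k = x at hk
      obtain ⟨j, c⟩ := x
      obtain ⟨rfl, hc⟩ := Sigma.mk.inj hk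
      exact ⟨c, rfl, eq_of_heq hc⟩
    choose c hc hcb using key
    refine ⟨i, c, (R i).mem_of_map (f i) c ?_, funext hc⟩
    rwa [show ((U i).map (f i) ∘ c) = b from funext hcb]

/-- The interpretable relation symbols of the product that are coproducts of interpretable relation
symbols of the factors. -/
def coprodSymbols (U : ∀ i, K i ⥤ Type w) (n : ℕ) : Set (RelSymbol (coprodU U) n) :=
  Set.range fun R : ∀ i, RelSymbol (U i) n => coprodSymbol U R

end Product

/-- The objects `A` with `φ_A = ψ_A`; the full subcategory on them is `Eq(φ, ψ)`. -/
def eqProp {K L : Type (w + 1)} [Category.{w} K] [Category.{w} L] {F G : K ⥤ L} (φ ψ : F ⟶ G) :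
    ObjectProperty K :=
  fun A => φ.app A = ψ.app A

/-- The product category `∏ K i` as an object of `Acc₃`, with the coproduct of the underlying sets. -/
def prodObj {I : Type w} (K : I → Acc3Obj.{w})
    (h : IsAcc3 (coprodU fun i => (K i).U)) : Acc3Obj.{w} where
  carrier := ∀ i, (K i).carrier
  U := coprodU fun i => (K i).U
  isAcc3 := h

/-- The category `Eq(φ, ψ)` as an object of `Acc₃`, with the underlying sets computed in `K`. -/
def eqObj {K L : Acc3Obj.{w}} {F G : K.carrier ⥤ L.carrier} (φ ψ : F ⟶ G)
    (h : IsAcc3 ((eqProp φ ψ).ι ⋙ K.U)) : Acc3Obj.{w} where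
  carrier := (eqProp φ ψ).FullSubcategory
  U := (eqProp φ ψ).ι ⋙ K.U
  isAcc3 := h

end AECat

open AECat

/-! Products. Filtered colimits in a product are computed componentwise, but the factors may be
accessible for different cardinals, and a common index has to be found. Raising the index is
possible because all directed colimits exist: a directed colimit of `κ`-presentable objects is the
`κ'`-directed colimit of its subcolimits over directed subsets of size `< κ'`, and these are
`κ'`-presentable (`isCardinalAccessibleCategory_of_lt`). A regular `μ` above all the indices and
above the size of `I` then works for the product.

Iso-fullness passes to the coproduct of the underlying sets because the unary symbols "lies in the
`i`-th summand" force a bijection to split into bijections of summands. Repleteness is obtained by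
relabelling: objects equipped with a bijection from their underlying set to an arbitrary set form an
equivalent category, replete by construction.

Equifiers. Naturality and the fact that `G f` is mono make `Eq(φ, ψ)` a sieve; since `F` preserves
filtered colimits, it is also closed under them. For any such class of objects (`IsFilteredSieve`)
the generators of `K` lying in it generate it, and the remaining axioms restrict along the full
inclusion. Pulling the sieve back along an equivalence with an AEC handles the clause "equivalent to
an AEC". -/

namespace AECat

/-! ### Raising the index of accessibility in the presence of directed colimits -/

section RaisingIndex

open Cardinal

attribute [local instance] Cardinal.fact_isRegular_aleph0

variable {κ' : Cardinal.{w}} [Fact κ'.IsRegular]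

/-- In a directed poset, a subset of cardinality less than an uncountable regular cardinal `κ'` is
contained in a directed subset of cardinality less than `κ'`. -/
theorem exists_isFiltered_set (h : ℵ₀ < κ') {X : Type w} [PartialOrder X] [IsFiltered X]
    (A : Set X) (hA : HasCardinalLT A κ') :
    ∃ B : Set X, A ⊆ B ∧ IsFiltered B ∧ HasCardinalLT B κ' := by
  have := (isCardinalFiltered_aleph0_iff.{w} X).2 inferInstance
  obtain ⟨B, hAB, hB, hB'⟩ :=
    SharplyLT.exists_isCardinalFiltered_set_of_exists_cofinal h (fun Y hY => by
      -- All finite subsets of `Y` form the cofinal family: there are fewer than `κ'` of them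
      -- because `κ'` is uncountable.
      refine ⟨Set.univ, ?_, fun B => ⟨B, Set.mem_univ _, le_rfl⟩⟩
      have hfin : HasCardinalLT (Finset Y) κ' := by
        rw [hasCardinalLT_iff_cardinal_mk_lt] at hY ⊢
        rcases finite_or_infinite Y with _ | _
        · exact (Cardinal.lt_aleph0_of_finite _).trans h
        · rwa [Cardinal.mk_finset_of_infinite]
      refine hfin.of_surjective
        (fun s => ⟨⟨(s : Set Y), by
          rw [hasCardinalLT_aleph0_iff]
          exact s.finite_toSet.to_subtype⟩, Set.mem_univ _⟩) ?_
      rintro ⟨⟨s, hs⟩, _⟩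
      rw [hasCardinalLT_aleph0_iff] at hs
      have hs' : s.Finite := hs
      exact ⟨hs'.toFinset, by simp⟩) A hA
  exact ⟨B, hAB, (isCardinalFiltered_aleph0_iff.{w} B).1 hB, hB'⟩

variable (κ') in
/-- The poset of directed subsets of cardinality less than `κ'`. -/
abbrev SmallDirectedSet (X : Type w) [PartialOrder X] : Type w :=
  {S : Set X // IsFiltered S ∧ HasCardinalLT S κ'}

omit [Fact κ'.IsRegular] in
theorem SmallDirectedSet.mem_of_hom {X : Type w} [PartialOrder X] {S T : SmallDirectedSet κ' X}
    (f : S ⟶ T) {x : X} (hx : x ∈ S.1) : x ∈ T.1 :=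
  leOfHom f hx

theorem SmallDirectedSet.exists_mem (h : ℵ₀ < κ') {X : Type w} [PartialOrder X] [IsFiltered X]
    (x : X) : ∃ S : SmallDirectedSet κ' X, x ∈ S.1 := by
  obtain ⟨B, hB, hB'⟩ := exists_isFiltered_set h {x} (hasCardinalLT_of_finite _ _ h.le)
  exact ⟨⟨B, hB'⟩, hB rfl⟩

/-- By regularity a union of fewer than `κ'` small sets is small, and it can be enlarged to a small
directed set. -/
theorem SmallDirectedSet.isCardinalFiltered (h : ℵ₀ < κ') (X : Type w) [PartialOrder X]
    [IsFiltered X] : IsCardinalFiltered (SmallDirectedSet κ' X) κ' :=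
  isCardinalFiltered_preorder _ _ fun ι S hι => by
    rw [← hasCardinalLT_iff_cardinal_mk_lt] at hι
    obtain ⟨B, hB, hB'⟩ := exists_isFiltered_set h (⋃ i, (S i).1)
      (hasCardinalLT_iUnion _ hι fun i => (S i).2.2)
    exact ⟨⟨B, hB'⟩, fun i => (Set.subset_iUnion (fun i => (S i).1) i).trans hB⟩

variable {C : Type*} [Category.{w} C] [HasFilteredColimitsOfSize.{w, w} C]
  {X : Type w} [PartialOrder X] (D : X ⥤ C)

/-- The restriction of a diagram on a poset to a subset. -/
abbrev restrictToSet (S : Set X) : S ⥤ C :=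
  (Subtype.mono_coe (· ∈ S)).functor ⋙ D

instance (S : SmallDirectedSet κ' X) : HasColimit (restrictToSet D S.1) := by
  have := S.2.1
  infer_instance

/-- The colimit of a diagram over a small directed subset. -/
noncomputable def smallColimit (S : SmallDirectedSet κ' X) : C :=
  colimit (restrictToSet D S.1)

namespace smallColimit

/-- The inclusions into `smallColimit D S`. -/
noncomputable def ι (S : SmallDirectedSet κ' X) {x : X} (hx : x ∈ S.1) :
    D.obj x ⟶ smallColimit D S :=
  colimit.ι (restrictToSet D S.1) ⟨x, hx⟩

omit [Fact κ'.IsRegular] in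
@[simp]
theorem w (S : SmallDirectedSet κ' X) {x y : X} (f : x ⟶ y) (hx : x ∈ S.1) (hy : y ∈ S.1) :
    D.map f ≫ ι D S hy = ι D S hx :=
  colimit.w (restrictToSet D S.1)
    (show (⟨x, hx⟩ : S.1) ⟶ ⟨y, hy⟩ from homOfLE (leOfHom f))

omit [Fact κ'.IsRegular] in
variable {D} in
theorem hom_ext {S : SmallDirectedSet κ' X} {Z : C} {f g : smallColimit D S ⟶ Z}
    (h : ∀ (x : X) (hx : x ∈ S.1), ι D S hx ≫ f = ι D S hx ≫ g) : f = g :=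
  colimit.hom_ext fun x => h x.1 x.2

variable {D} in
/-- The morphism from `smallColimit D S` given by a compatible family of morphisms. -/
noncomputable def desc {S : SmallDirectedSet κ' X} {Z : C} (t : ∀ x ∈ S.1, (D.obj x ⟶ Z))
    (ht : ∀ (x y : X) (f : x ⟶ y) (hx : x ∈ S.1) (hy : y ∈ S.1), D.map f ≫ t y hy = t x hx) :
    smallColimit D S ⟶ Z :=
  colimit.desc (restrictToSet D S.1)
    { pt := Z
      ι :=
        { app := fun x => t x.1 x.2
          naturality := fun x y f =>
            (ht x.1 y.1 (homOfLE (leOfHom f)) x.2 y.2).trans (Category.comp_id _).symm } }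

omit [Fact κ'.IsRegular] in
variable {D} in
@[simp]
theorem ι_desc {S : SmallDirectedSet κ' X} {Z : C} (t : ∀ x ∈ S.1, (D.obj x ⟶ Z))
    (ht : ∀ (x y : X) (f : x ⟶ y) (hx : x ∈ S.1) (hy : y ∈ S.1), D.map f ≫ t y hy = t x hx)
    {x : X} (hx : x ∈ S.1) : ι D S hx ≫ desc t ht = t x hx :=
  colimit.ι_desc (F := restrictToSet D S.1) _ ⟨x, hx⟩

end smallColimit

variable (κ') in
/-- The diagram of the colimits of a given diagram over small directed subsets. -/
noncomputable abbrev smallColimits : SmallDirectedSet κ' X ⥤ C where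
  obj S := smallColimit D S
  map {S T} f := smallColimit.desc
    (fun _ hx => smallColimit.ι D T (SmallDirectedSet.mem_of_hom f hx))
    (fun _ _ g _ _ => smallColimit.w D T g _ _)
  map_id S := smallColimit.hom_ext (by simp)
  map_comp f g := smallColimit.hom_ext (by simp [← Category.assoc])

omit [Fact κ'.IsRegular] in
@[simp]
theorem ι_smallColimits_map {S T : SmallDirectedSet κ' X} (f : S ⟶ T) {x : X} (hx : x ∈ S.1) :
    smallColimit.ι D S hx ≫ (smallColimits κ' D).map f =
      smallColimit.ι D T (SmallDirectedSet.mem_of_hom f hx) := by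
  simp [smallColimits]

variable {D} (c : Cocone D)

variable (κ') in
/-- The natural transformation from `smallColimits` induced by a cocone. -/
noncomputable def smallColimitsι :
    smallColimits κ' D ⟶ (Functor.const (SmallDirectedSet κ' X)).obj c.pt where
  app S := smallColimit.desc (fun x _ => c.ι.app x) (by simp)
  naturality S T f := smallColimit.hom_ext fun x hx => by
    simp [← Category.assoc]

omit [Fact κ'.IsRegular] in
@[simp]
theorem ι_smallColimitsι (S : SmallDirectedSet κ' X) {x : X} (hx : x ∈ S.1) :
    smallColimit.ι D S hx ≫ (smallColimitsι κ' c).app S = c.ι.app x := by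
  simp [smallColimitsι]

/-- Both sides agree with the composite through a common upper bound of `S` and `T`. Hence the
arbitrary choice of a small directed set around each `x` in `coconeOfSmallColimits` is harmless. -/
theorem ι_app_eq_of_mem (h : ℵ₀ < κ') [IsFiltered X] (s : Cocone (smallColimits κ' D))
    {S T : SmallDirectedSet κ' X} {x : X} (hS : x ∈ S.1) (hT : x ∈ T.1) :
    smallColimit.ι D S hS ≫ s.ι.app S = smallColimit.ι D T hT ≫ s.ι.app T := by
  have := SmallDirectedSet.isCardinalFiltered h X
  have := isFiltered_of_isCardinalFiltered (SmallDirectedSet κ' X) κ'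
  rw [← s.w (IsFiltered.leftToMax S T), ← s.w (IsFiltered.rightToMax S T),
    ← Category.assoc, ← Category.assoc, ι_smallColimits_map, ι_smallColimits_map]

/-- The cocone on a diagram induced by a cocone on the colimits over its small directed
subdiagrams. -/
noncomputable abbrev coconeOfSmallColimits (h : ℵ₀ < κ') [IsFiltered X]
    (s : Cocone (smallColimits κ' D)) : Cocone D where
  pt := s.pt
  ι :=
    { app := fun x => smallColimit.ι D _ (SmallDirectedSet.exists_mem h x).choose_spec ≫ s.ι.app _
      naturality := fun x y f => by
        have := SmallDirectedSet.isCardinalFiltered h X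
        have := isFiltered_of_isCardinalFiltered (SmallDirectedSet κ' X) κ'
        obtain ⟨S, hS⟩ := SmallDirectedSet.exists_mem h x
        obtain ⟨T, hT⟩ := SmallDirectedSet.exists_mem h y
        have hx : x ∈ (IsFiltered.max S T).1 := leOfHom (IsFiltered.leftToMax S T) hS
        have hy : y ∈ (IsFiltered.max S T).1 := leOfHom (IsFiltered.rightToMax S T) hT
        dsimp only [Functor.const_obj_obj, Functor.const_obj_map]
        rw [ι_app_eq_of_mem h s _ hx, ι_app_eq_of_mem h s _ hy, ← Category.assoc,
          smallColimit.w D _ f hx hy, Category.comp_id] }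

theorem coconeOfSmallColimits_ι_app (h : ℵ₀ < κ') [IsFiltered X]
    (s : Cocone (smallColimits κ' D)) {S : SmallDirectedSet κ' X} {x : X} (hx : x ∈ S.1) :
    (coconeOfSmallColimits h s).ι.app x = smallColimit.ι D S hx ≫ s.ι.app S :=
  ι_app_eq_of_mem h s _ _

/-- A directed colimit is the `κ'`-directed colimit of the colimits over its directed subdiagrams of
size less than `κ'`. -/
noncomputable def isColimitSmallColimits (h : ℵ₀ < κ') [IsFiltered X] (hc : IsColimit c) :
    IsColimit (Cocone.mk c.pt (smallColimitsι κ' c)) where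
  desc s := hc.desc (coconeOfSmallColimits h s)
  fac s S := smallColimit.hom_ext fun x hx => by
    rw [← coconeOfSmallColimits_ι_app h s hx, ← hc.fac, ← Category.assoc, ι_smallColimitsι]
  uniq s m hm := hc.hom_ext fun x => by
    obtain ⟨S, hS⟩ := SmallDirectedSet.exists_mem h x
    rw [hc.fac, coconeOfSmallColimits_ι_app h s hS, ← hm, ← Category.assoc, ι_smallColimitsι]

omit [Fact κ'.IsRegular] in
theorem hasCardinalLT_arrow_of_preorder {S : Type w} [Preorder S] (h : ℵ₀ ≤ κ')
    (hS : HasCardinalLT S κ') : HasCardinalLT (Arrow S) κ' :=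
  (hasCardinalLT_prod h hS hS).of_injective (fun f => (f.left, f.right)) fun f g hfg => by
    obtain ⟨a, b, f⟩ := f
    obtain ⟨a', b', g⟩ := g
    obtain ⟨rfl, rfl⟩ : a = a' ∧ b = b' := by simpa using hfg
    rw [Subsingleton.elim f g]

variable (C) in
/-- A `κ`-accessible category with filtered colimits is `κ'`-accessible for all `κ' > κ`. -/
theorem isCardinalAccessibleCategory_of_lt {κ : Cardinal.{w}} [Fact κ.IsRegular]
    [IsCardinalAccessibleCategory C κ] (h : κ < κ') : IsCardinalAccessibleCategory C κ' := by
  have hκ : ℵ₀ < κ' := (Cardinal.IsRegular.aleph0_le Fact.out).trans_lt h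
  obtain ⟨P, _, hP⟩ := HasCardinalFilteredGenerator.exists_generator C κ
  -- The new generator is the closure of the old one under colimits of size `< κ'`.
  have hle : P.colimitsCardinalClosure κ' ≤ isCardinalPresentable C κ' :=
    P.colimitsCardinalClosure_le κ'
      (fun J _ hJ => isClosedUnderColimitsOfShape_isCardinalPresentable C hJ)
      (hP.le_isCardinalPresentable.trans (isCardinalPresentable_monotone C h.le))
  have hgen : (P.colimitsCardinalClosure κ').IsCardinalFilteredGenerator κ' :=
    { le_isCardinalPresentable := hle
      exists_colimitsOfShape := fun A => by
        obtain ⟨J, _, _, ⟨p⟩⟩ := hP.exists_colimitsOfShape A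
        -- Directed subsets make sense in a poset, so `J` is replaced by a directed poset with a
        -- final functor to it.
        obtain ⟨X, _, _, G, _⟩ := IsCardinalFiltered.exists_cardinal_directed J κ
        have := isFiltered_of_isCardinalFiltered X κ
        let q := p.reindex G
        refine ⟨SmallDirectedSet κ' X, inferInstance, SmallDirectedSet.isCardinalFiltered hκ X,
          ⟨{ diag := smallColimits κ' q.diag
             ι := smallColimitsι κ' (Cocone.mk A q.ι)
             isColimit := isColimitSmallColimits _ hκ q.isColimit
             prop_diag_obj := fun S => ?_ }⟩⟩
        have := P.isClosedUnderColimitsOfShape_colimitsCardinalClosure κ' S.1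
          (hasCardinalLT_arrow_of_preorder hκ.le S.2.2)
        exact ObjectProperty.prop_colimit _ _ fun x =>
          P.le_colimitsCardinalClosure κ' _ (q.prop_diag_obj _) }
  have := hgen.hasCardinalFilteredGenerator
  exact
    { toHasCardinalFilteredColimits := ⟨fun J _ _ => by
        have := isFiltered_of_isCardinalFiltered J κ'
        infer_instance⟩ }

end RaisingIndex

/-! ### Componentwise colimits in products -/

section ProductColimits

variable {I : Type w} {K : I → Type (w + 1)} [∀ i, Category.{w} (K i)]
  {J : Type w} [SmallCategory J]

theorem hasColimitsOfShape_pi [∀ i, HasColimitsOfShape J (K i)] :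
    HasColimitsOfShape J (∀ i, K i) :=
  ⟨fun _ => pi.hasColimit_of_hasColimit_comp_eval⟩

theorem preservesColimitsOfShape_eval [∀ i, HasColimitsOfShape J (K i)] (i : I) :
    PreservesColimitsOfShape J (Pi.eval K i) :=
  ⟨fun {F} => preservesColimit_of_preserves_colimit_cocone
    (pi.coconeOfCoconeEvalIsColimit fun i => colimit.isColimit (F ⋙ Pi.eval K i))
    (colimit.isColimit (F ⋙ Pi.eval K i))⟩

theorem preservesColimitsOfShape_of_comp_eval {H : Type*} [Category* H] (Q : H ⥤ ∀ i, K i)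
    (hQ : ∀ i, PreservesColimitsOfShape J (Q ⋙ Pi.eval K i)) : PreservesColimitsOfShape J Q :=
  ⟨fun {F} => ⟨fun {c} hc => ⟨pi.coconeOfCoconeEvalIsColimit (F := F ⋙ Q)
    (c := fun i => (Q ⋙ Pi.eval K i).mapCocone c) fun _ => isColimitOfPreserves _ hc⟩⟩⟩

theorem hasFilteredColimits_pi [∀ i, HasFilteredColimitsOfSize.{w, w} (K i)] :
    HasFilteredColimitsOfSize.{w, w} (∀ i, K i) :=
  ⟨fun _ _ _ => hasColimitsOfShape_pi⟩

theorem preservesFilteredColimits_eval [∀ i, HasFilteredColimitsOfSize.{w, w} (K i)] (i : I) :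
    PreservesFilteredColimitsOfSize.{w, w} (Pi.eval K i) :=
  ⟨fun _ _ _ => preservesColimitsOfShape_eval i⟩

theorem preservesFilteredColimits_of_comp_eval {H : Type*} [Category* H] (Q : H ⥤ ∀ i, K i)
    (hQ : ∀ i, PreservesFilteredColimitsOfSize.{w, w} (Q ⋙ Pi.eval K i)) :
    PreservesFilteredColimitsOfSize.{w, w} Q :=
  ⟨fun _ _ _ => preservesColimitsOfShape_of_comp_eval Q fun _ => inferInstance⟩

end ProductColimits

/-- A functor preserving filtered colimits is accessible. -/
theorem isAccessible_of_preservesFilteredColimits {C D : Type*} [Category* C] [Category* D]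
    (F : C ⥤ D) [PreservesFilteredColimitsOfSize.{w, w} F] : Functor.IsAccessible.{w} F := by
  have := Cardinal.fact_isRegular_aleph0.{w}
  have : F.IsCardinalAccessible (Cardinal.aleph0 : Cardinal.{w}) := ⟨fun J _ _ => by
    have := isFiltered_of_isCardinalFiltered J Cardinal.aleph0.{w}
    infer_instance⟩
  exact Functor.isAccessible_of_isCardinalAccessible F Cardinal.aleph0

/-- There is a regular cardinal larger than each member of a family of cardinals, and than the
size of the index set. -/
theorem exists_regular_gt {I : Type w} (κ : I → Cardinal.{w}) :
    ∃ μ : Cardinal.{w}, μ.IsRegular ∧ (∀ i, κ i < μ) ∧ HasCardinalLT I μ := by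
  obtain ⟨μ, hμ, h⟩ := HasCardinalLT.exists_regular_cardinal_forall.{w}
    (fun i : Option I => i.elim I fun i => (κ i).out)
  exact ⟨μ, hμ, fun i => by simpa [hasCardinalLT_iff_cardinal_mk_lt] using h (some i), h none⟩

/-! ### Accessibility of products -/

section ProductAccessible

variable {I : Type w} {K : I → Type (w + 1)} [∀ i, Category.{w} (K i)]

/-- Factorizations and equalizing stages are found in each component; there are fewer than `μ` of
them, so a `μ`-filtered diagram has one stage beyond all. -/
theorem isCardinalPresentable_pi {μ : Cardinal.{w}} [Fact μ.IsRegular] (hI : HasCardinalLT I μ)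
    [∀ i, HasFilteredColimitsOfSize.{w, w} (K i)] (A : ∀ i, K i)
    (hA : ∀ i, IsCardinalPresentable (A i) μ) : IsCardinalPresentable A μ where
  preservesColimitOfShape J _ _ := by
    have := isFiltered_of_isCardinalFiltered J μ
    refine ⟨fun {F} => ⟨fun {c} hc => ⟨?_⟩⟩⟩
    have hci (i : I) : IsColimit ((Pi.eval K i).mapCocone c) :=
      have := preservesFilteredColimits_eval (K := K) i
      isColimitOfPreserves _ hc
    refine Types.FilteredColimit.isColimitOf' _ _ (fun (f : A ⟶ c.pt) => ?_)
      (fun j (f : A ⟶ F.obj j) (g : A ⟶ F.obj j) hfg => ?_)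
    · choose j g hg using fun i =>
        IsCardinalPresentable.exists_hom_of_isColimit μ (hci i) (f i)
      let g' : A ⟶ F.obj (IsCardinalFiltered.max j hI) :=
        fun i => g i ≫ F.map (IsCardinalFiltered.toMax j hI i) i
      refine ⟨_, g', (funext fun i => ?_ : f = g' ≫ c.ι.app _)⟩
      have hw := congr_fun (c.w (IsCardinalFiltered.toMax j hI i)) i
      exact (hg i).symm.trans ((congrArg (g i ≫ ·) hw.symm).trans (Category.assoc _ _ _).symm)
    · replace hfg : f ≫ c.ι.app j = g ≫ c.ι.app j := hfg
      choose k u hu using fun i =>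
        IsCardinalPresentable.exists_eq_of_isColimit' μ (hci i) (f i) (g i) (congr_fun hfg i)
      obtain ⟨m, a, b, hab⟩ := IsCardinalFiltered.wideSpan u hI
      refine ⟨m, b, (funext fun i => ?_ : f ≫ F.map b = g ≫ F.map b)⟩
      have hm : F.map b i = F.map (u i) i ≫ F.map (a i) i := by
        rw [← hab i, F.map_comp]
        rfl
      change f i ≫ F.map b i = g i ≫ F.map b i
      rw [hm, ← Category.assoc, ← Category.assoc]
      exact congrArg (fun x => x ≫ F.map (a i) i) (hu i)

theorem essentiallySmall_pi (P : ∀ i, ObjectProperty (K i))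
    [∀ i, ObjectProperty.Small.{w} (P i)] :
    ObjectProperty.EssentiallySmall.{w} (fun A : ∀ i, K i => ∀ i, P i (A i)) := by
  have : ObjectProperty.Small.{w} (fun A : ∀ i, K i => ∀ i, P i (A i)) :=
    small_of_surjective
      (f := fun A : (∀ i, Subtype (P i)) => ⟨fun i => (A i).1, fun i => (A i).2⟩)
      (fun A => ⟨fun i => ⟨A.1 i, A.2 i⟩, rfl⟩)
  infer_instance

/-- If each `A i` is a colimit of generators over `J i`, then `A` is a colimit of families of
generators over `∀ i, J i`, because the projections to the `J i` are final. -/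
theorem isCardinalAccessibleCategory_pi {μ : Cardinal.{w}} [Fact μ.IsRegular]
    (hI : HasCardinalLT I μ) [∀ i, HasFilteredColimitsOfSize.{w, w} (K i)]
    [∀ i, IsCardinalAccessibleCategory (K i) μ] :
    IsCardinalAccessibleCategory (∀ i, K i) μ := by
  choose P hP hgen using fun i => HasCardinalFilteredGenerator.exists_small_generator (K i) μ
  have := essentiallySmall_pi P
  have := hasFilteredColimits_pi (K := K)
  have hgen' : ObjectProperty.IsCardinalFilteredGenerator
      (fun A : ∀ i, K i => ∀ i, P i (A i)) μ :=
    { le_isCardinalPresentable := fun A hA =>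
        isCardinalPresentable_pi hI A fun i => (hgen i).le_isCardinalPresentable _ (hA i)
      exists_colimitsOfShape := fun A => by
        choose J _ _ p using fun i => (hgen i).exists_colimitsOfShape (A i)
        have (i : I) := isFiltered_of_isCardinalFiltered (J i) μ
        let q (i : I) := (p i).some.reindex (Pi.eval J i)
        exact ⟨∀ i, J i, inferInstance, inferInstance,
          ⟨{ diag := Functor.pi' fun i => (q i).diag
             ι := NatTrans.pi' fun i => (q i).ι
             isColimit := pi.coconeOfCoconeEvalIsColimit
               (F := Functor.pi' fun i => (q i).diag) fun i => (q i).isColimit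
             prop_diag_obj := fun j i => (q i).prop_diag_obj j }⟩⟩ }
  have := hgen'.hasCardinalFilteredGenerator
  exact
    { toHasCardinalFilteredColimits := ⟨fun J _ _ => by
        have := isFiltered_of_isCardinalFiltered J μ
        infer_instance⟩ }

theorem IsAcc0.pi (h : ∀ i, IsAcc0.{w} (K i)) : IsAcc0.{w} (∀ i, K i) := by
  have (i : I) := (h i).hasDirectedColimits
  choose κ hκ hacc using fun i => (h i).accessible.exists_cardinal
  obtain ⟨μ, hμ, hlt, hI⟩ := exists_regular_gt κ
  have : Fact μ.IsRegular := ⟨hμ⟩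
  have (i : I) := isCardinalAccessibleCategory_of_lt (K i) (hlt i)
  exact ⟨⟨μ, ⟨hμ⟩, isCardinalAccessibleCategory_pi hI⟩, hasFilteredColimits_pi⟩

/-- A functor to a product is accessible if its components are. -/
theorem isAccessible_of_comp_eval {H : Type*} [Category* H] (Q : H ⥤ ∀ i, K i)
    (hQ : ∀ i, Functor.IsAccessible.{w} (Q ⋙ Pi.eval K i)) : Functor.IsAccessible.{w} Q := by
  choose κ hκ hacc using fun i => (hQ i).exists_cardinal
  obtain ⟨μ, hμ, hlt, -⟩ := exists_regular_gt κ
  have : Fact μ.IsRegular := ⟨hμ⟩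
  have (i : I) := Functor.isCardinalAccessible_of_le (Q ⋙ Pi.eval K i) (hlt i).le
  exact ⟨μ, ⟨hμ⟩, ⟨fun J _ _ => preservesColimitsOfShape_of_comp_eval Q fun i =>
    (Q ⋙ Pi.eval K i).preservesColimitsOfShape_of_isCardinalAccessible μ J⟩⟩

end ProductAccessible

/-! ### Iso-fullness as detection of isomorphisms by symbols -/

section IsoFull

variable {K : Type (w + 1)} [Category.{w} K] {U : K ⥤ Type w}

/-- An isomorphism of structures, as a bijection. -/
@[simps]
def embIsoEquiv {S : FirstOrder.Language.{0, w + 1}} {X Y : Emb S} (f : X ≅ Y) :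
    X.carrier ≃ Y.carrier where
  toFun := FirstOrder.Language.Embedding.toEmbedding f.hom
  invFun := FirstOrder.Language.Embedding.toEmbedding f.inv
  left_inv x := congrArg (fun g : X ⟶ X => FirstOrder.Language.Embedding.toEmbedding g x)
    f.hom_inv_id
  right_inv x := congrArg (fun g : Y ⟶ Y => FirstOrder.Language.Embedding.toEmbedding g x)
    f.inv_hom_id

/-- A bijection preserving and reflecting all relations, as an isomorphism of structures for a
relational signature. -/
def embIsoMk {X Y : Emb (sig U)} (e : X.carrier ≃ Y.carrier)
    (he : ∀ (n : ℕ) (R : RelSymbol U n) (a : Fin n → X.carrier),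
      X.str.RelMap (show (sig U).Relations n from R) a ↔
        Y.str.RelMap (show (sig U).Relations n from R) (e ∘ a)) : X ≅ Y where
  hom :=
    (show FirstOrder.Language.Embedding (sig U) X.carrier Y.carrier from
    { toFun := e
      inj' := e.injective
      map_fun' := fun g => Empty.elim g
      map_rel' := fun R a => (he _ R a).symm })
  inv :=
    (show FirstOrder.Language.Embedding (sig U) Y.carrier X.carrier from
    { toFun := e.symm
      inj' := e.symm.injective
      map_fun' := fun g => Empty.elim g
      map_rel' := fun R a => by
        have := he _ R (e.symm ∘ a)
        rwa [← Function.comp_assoc, e.self_comp_symm, Function.id_comp] at this })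
  hom_inv_id := Emb.hom_ext _ _ fun x => e.symm_apply_apply x
  inv_hom_id := Emb.hom_ext _ _ fun x => e.apply_symm_apply x

/-- Iso-fullness means that the interpretable relation symbols detect isomorphisms. -/
theorem isoFull_iff (hU : ConcreteMonos U) :
    IsoFull U hU ↔ DetectsIsos U fun _ => Set.univ := by
  constructor
  · intro h A B f hf
    let g : (E U hU).obj A ≅ (E U hU).obj B :=
      embIsoMk (X := (E U hU).obj A) (Y := (E U hU).obj B) f
        fun n R a => hf n R (Set.mem_univ _) a
    obtain ⟨fbar, hfbar⟩ := h g
    exact ⟨fbar, fun x => congrArg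
      (fun k : (E U hU).obj A ≅ (E U hU).obj B => embIsoEquiv k x) hfbar⟩
  · intro h A B f
    obtain ⟨fbar, hfbar⟩ := h (embIsoEquiv f)
      fun n R _ a => (FirstOrder.Language.Embedding.map_rel' f.hom R a).symm
    exact ⟨fbar, Iso.ext (Emb.hom_ext _ _ hfbar)⟩

theorem DetectsIsos.mono {S T : ∀ n, Set (RelSymbol U n)} (h : DetectsIsos U S)
    (hST : ∀ n, S n ⊆ T n) : DetectsIsos U T :=
  fun _ _ f hf => h f fun n R hR => hf n R (hST n hR)

end IsoFull

/-! ### The coproduct of the underlying sets -/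

section Coproduct

variable {I : Type w} {K : I → Type (w + 1)} [∀ i, Category.{w} (K i)]
  {U : ∀ i, K i ⥤ Type w}

theorem coprodU_map_mk {A B : ∀ i, K i} (f : A ⟶ B) (i : I) (x : (U i).obj (A i)) :
    (coprodU U).map f ⟨i, x⟩ = (⟨i, (U i).map (f i) x⟩ : Σ i, (U i).obj (B i)) :=
  rfl

theorem faithful_coprodU [∀ i, (U i).Faithful] : (coprodU U).Faithful where
  map_injective {A B} f g hfg := funext fun i => (U i).map_injective <| by
    ext x
    have := ConcreteCategory.congr_hom hfg (⟨i, x⟩ : Σ i, (U i).obj (A i))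
    exact eq_of_heq (Sigma.mk.inj this).2

/-- Every element lies in one summand, and elements that become equal lie in the same one, so both
conditions reduce to a single `U i`. -/
theorem preserves_coprodU [∀ i, HasFilteredColimitsOfSize.{w, w} (K i)]
    [∀ i, PreservesFilteredColimitsOfSize.{w, w} (U i)] :
    PreservesFilteredColimitsOfSize.{w, w} (coprodU U) := by
  refine ⟨fun J _ _ => ⟨fun {F} => ⟨fun {c} hc => ⟨?_⟩⟩⟩⟩
  have hci (i : I) : IsColimit ((Pi.eval K i ⋙ U i).mapCocone c) :=
    have := preservesFilteredColimits_eval (K := K) i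
    isColimitOfPreserves _ hc
  refine Types.FilteredColimit.isColimitOf' _ _ ?_ ?_
  · rintro ⟨i, x⟩
    obtain ⟨j, y, rfl⟩ := Types.jointly_surjective_of_isColimit (hci i) x
    exact ⟨j, (⟨i, y⟩ : Σ i, (U i).obj (F.obj j i)), rfl⟩
  · rintro j ⟨i, x⟩ ⟨i', y⟩ hxy
    obtain ⟨rfl, hxy⟩ := Sigma.mk.inj hxy
    obtain ⟨k, f, hf⟩ := (Types.FilteredColimit.isColimit_eq_iff' (hci i) x y).1 (eq_of_heq hxy)
    exact ⟨k, f, congrArg (Sigma.mk i) hf⟩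

/-- The maps underlying `g` and `k` keep the summand index, so `f` must keep it too and splits into
maps to which coherence of each `U i` applies. -/
theorem coherent_coprodU (h : ∀ i, IsCoherent (U i)) : IsCoherent (coprodU U) := by
  intro A B C k g f hf
  have key (i : I) (x : (U i).obj (A i)) : ∃ y : (U i).obj (B i),
      f (⟨i, x⟩ : Σ i, (U i).obj (A i)) = (⟨i, y⟩ : Σ i, (U i).obj (B i)) ∧
        (U i).map (g i) y = (U i).map (k i) x := by
    have hx := ConcreteCategory.congr_hom hf (⟨i, x⟩ : Σ i, (U i).obj (A i))
    replace hx : (coprodU U).map g (f (⟨i, x⟩ : Σ i, (U i).obj (A i))) =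
      (coprodU U).map k (⟨i, x⟩ : Σ i, (U i).obj (A i)) := hx
    generalize f (⟨i, x⟩ : Σ i, (U i).obj (A i)) = z at hx
    obtain ⟨j, y⟩ := z
    obtain ⟨rfl, hy⟩ := Sigma.mk.inj hx
    exact ⟨y, rfl, eq_of_heq hy⟩
  choose φ hφ hgφ using key
  choose fbar hfbar using fun i => h i (k i) (g i) (TypeCat.ofHom (φ i))
    (by ext x; exact hgφ i x)
  refine ⟨fbar, ?_⟩
  apply ConcreteCategory.hom_ext
  rintro ⟨i, x⟩
  refine Eq.trans ?_ (hφ i x).symm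
  rw [coprodU_map_mk, hfbar]
  rfl

theorem concreteMonos_coprodU (h : ∀ i, ConcreteMonos (U i)) : ConcreteMonos (coprodU U) where
  mono A B f := ⟨fun g k hgk => funext fun i => by
    have := (h i).mono (f i)
    exact (cancel_mono (f i)).1 (congr_fun hgk i)⟩
  mono_map A B f := by
    rw [mono_iff_injective]
    rintro ⟨i, x⟩ ⟨i', y⟩ hxy
    obtain ⟨rfl, hxy⟩ := Sigma.mk.inj hxy
    exact congrArg (Sigma.mk i) ((mono_iff_injective _).1 ((h i).mono_map (f i)) (eq_of_heq hxy))

theorem IsAcc2.coprodU (h : ∀ i, IsAcc2 (U i)) : IsAcc2 (coprodU U) where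
  toIsAcc0 := IsAcc0.pi fun i => (h i).toIsAcc0
  faithful := have (i : I) := (h i).faithful; faithful_coprodU
  preserves :=
    have (i : I) := (h i).hasDirectedColimits
    have (i : I) := (h i).preserves
    preserves_coprodU
  coherent := coherent_coprodU fun i => (h i).coherent
  concreteMonos := concreteMonos_coprodU fun i => (h i).concreteMonos

/-- The empty relation. -/
def emptySymbol {K : Type (w + 1)} [Category.{w} K] (U : K ⥤ Type w) (n : ℕ) :
    RelSymbol U n where
  rel _ := ∅
  map_mem _ _ h := h
  mem_of_map _ _ h := h

/-- The full relation. -/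
def univSymbol {K : Type (w + 1)} [Category.{w} K] (U : K ⥤ Type w) (n : ℕ) :
    RelSymbol U n where
  rel _ := Set.univ
  map_mem _ _ h := h
  mem_of_map _ _ _ := trivial

open Classical in
/-- The relation `R` on the `i`-th summand of the coproduct. -/
noncomputable def summandSymbol {n : ℕ} (i : I) (R : RelSymbol (U i) n) :
    RelSymbol (AECat.coprodU U) n :=
  coprodSymbol U (Function.update (fun j => emptySymbol (U j) n) i R)

theorem summandSymbol_mem {n : ℕ} (i : I) (R : RelSymbol (U i) n) :
    summandSymbol i R ∈ coprodSymbols U n :=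
  ⟨_, rfl⟩

-- The empty relation on the other summands makes this hold even for `n = 0`, where the tuple does
-- not determine a summand.
open Classical in
theorem mem_summandSymbol_iff {n : ℕ} (i : I) (R : RelSymbol (U i) n) (A : ∀ i, K i)
    (a : Fin n → Σ i, (U i).obj (A i)) :
    a ∈ (summandSymbol i R).rel A ↔ ∃ b ∈ R.rel (A i), a = fun k => ⟨i, b k⟩ := by
  constructor
  · rintro ⟨j, b, hb, rfl⟩
    by_cases hij : j = i
    · subst hij
      rw [Function.update_self] at hb
      exact ⟨b, hb, rfl⟩
    · rw [Function.update_of_ne hij] at hb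
      exact hb.elim
  · rintro ⟨b, hb, rfl⟩
    exact ⟨i, b, by rwa [Function.update_self], rfl⟩

theorem mk_comp_mem_summandSymbol_iff {n : ℕ} (i : I) (R : RelSymbol (U i) n) (A : ∀ i, K i)
    (b : Fin n → (U i).obj (A i)) :
    (fun k => ⟨i, b k⟩ : Fin n → Σ i, (U i).obj (A i)) ∈ (summandSymbol i R).rel A ↔
      b ∈ R.rel (A i) := by
  rw [mem_summandSymbol_iff]
  constructor
  · rintro ⟨c, hc, hbc⟩
    obtain rfl : b = c := funext fun k => eq_of_heq (Sigma.mk.inj (congr_fun hbc k)).2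
    exact hc
  · exact fun hb => ⟨b, hb, rfl⟩

theorem detectsIsos_coprodSymbols (h : ∀ i, DetectsIsos (U i) fun _ => Set.univ) :
    DetectsIsos (AECat.coprodU U) (coprodSymbols U) := by
  intro A B (f : (Σ i, (U i).obj (A i)) ≃ (Σ i, (U i).obj (B i))) hf
  replace hf {n : ℕ} (i : I) (R : RelSymbol (U i) n) (a : Fin n → Σ i, (U i).obj (A i)) :
      a ∈ (summandSymbol i R).rel A ↔ (f ∘ a) ∈ (summandSymbol i R).rel B :=
    hf n _ (summandSymbol_mem i R) a
  -- The full unary relation on the `i`-th summand shows that `f`, and likewise its inverse,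
  -- respects summands.
  have hto (i : I) (x : (U i).obj (A i)) : ∃ y : (U i).obj (B i), f ⟨i, x⟩ = ⟨i, y⟩ := by
    obtain ⟨b, -, hb⟩ := (mem_summandSymbol_iff i _ B _).1
      ((hf i (univSymbol (U i) 1) fun _ => ⟨i, x⟩).1
        ((mk_comp_mem_summandSymbol_iff i _ A fun _ => x).2 trivial))
    exact ⟨b 0, congr_fun hb 0⟩
  have hinv (i : I) (y : (U i).obj (B i)) : ∃ x : (U i).obj (A i), f.symm ⟨i, y⟩ = ⟨i, x⟩ := by
    obtain ⟨b, -, hb⟩ := (mem_summandSymbol_iff i _ A _).1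
      ((hf i (univSymbol (U i) 1) fun _ => f.symm ⟨i, y⟩).2 (by
        rw [show (f ∘ fun _ : Fin 1 => f.symm ⟨i, y⟩) = fun _ => ⟨i, y⟩ from
          funext fun _ => f.apply_symm_apply _]
        exact (mk_comp_mem_summandSymbol_iff i _ B fun _ => y).2 trivial))
    exact ⟨b 0, congr_fun hb 0⟩
  choose φ hφ using hto
  choose ψ hψ using hinv
  let e (i : I) : (U i).obj (A i) ≃ (U i).obj (B i) :=
    { toFun := φ i
      invFun := ψ i
      left_inv := fun x => by
        have := hψ i (φ i x)
        rw [← hφ, f.symm_apply_apply] at this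
        exact (eq_of_heq (Sigma.mk.inj this).2).symm
      right_inv := fun y => by
        have := hφ i (ψ i y)
        rw [← hψ, f.apply_symm_apply] at this
        exact (eq_of_heq (Sigma.mk.inj this).2).symm }
  choose fbar hfbar using fun i => h i (e i) fun n R _ a => by
    rw [← mk_comp_mem_summandSymbol_iff i R A a, ← mk_comp_mem_summandSymbol_iff i R B (e i ∘ a),
      hf i R]
    exact iff_of_eq (congrArg (· ∈ (summandSymbol i R).rel B) (funext fun k => hφ i (a k)))
  refine ⟨Pi.isoMk fbar, ?_⟩
  rintro ⟨i, x⟩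
  exact (congrArg (Sigma.mk i) (hfbar i x)).trans (hφ i x).symm

theorem isoFull_coprodU (hU : ∀ i, ConcreteMonos (U i)) (h : ∀ i, IsoFull (U i) (hU i)) :
    IsoFull (AECat.coprodU U) (concreteMonos_coprodU hU) :=
  (isoFull_iff _).2 <| (detectsIsos_coprodSymbols fun i => (isoFull_iff (hU i)).1 (h i)).mono
    fun _ => Set.subset_univ _

end Coproduct

/-! ### Transfer of the axioms along fully faithful functors -/

section FullyFaithful

variable {K L : Type (w + 1)} [Category.{w} K] [Category.{w} L] {U : K ⥤ Type w} {V : L ⥤ Type w}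
  (F : L ⥤ K) [F.Full] [F.Faithful] (i : V ≅ F ⋙ U)

omit [F.Faithful] in
include i in
theorem IsCoherent.of_iso (h : IsCoherent U) : IsCoherent V := by
  intro A B C k g f hf
  obtain ⟨fbar, hfbar⟩ := h (F.map k) (F.map g) (i.inv.app A ≫ f ≫ i.hom.app B) (by
    have h₁ := i.hom.naturality g
    have h₂ := i.inv.naturality k
    rw [Functor.comp_map] at h₁ h₂
    rw [Category.assoc, Category.assoc, ← h₁, reassoc_of% hf, ← Category.assoc, ← h₂,
      Category.assoc, Iso.inv_hom_id_app]
    exact Category.comp_id _)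
  refine ⟨F.preimage fbar, ?_⟩
  have h₃ := i.hom.naturality (F.preimage fbar)
  rw [Functor.comp_map, F.map_preimage, hfbar, Iso.hom_inv_id_app_assoc] at h₃
  exact (cancel_mono (i.hom.app B)).1 h₃

omit [F.Full] in
include i in
theorem ConcreteMonos.of_iso (h : ConcreteMonos U) : ConcreteMonos V where
  mono A B f :=
    have := h.mono (F.map f)
    F.mono_of_mono_map this
  mono_map A B f := by
    have := h.mono_map (F.map f)
    rw [show V.map f = i.hom.app A ≫ U.map (F.map f) ≫ i.inv.app B from
      by simp [← Functor.comp_map]]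
    infer_instance

include i in
theorem IsAcc2.of_iso (hL : IsAcc0.{w} L) [PreservesFilteredColimitsOfSize.{w, w} F]
    (h : IsAcc2 U) : IsAcc2 V where
  toIsAcc0 := hL
  faithful := have := h.faithful; Functor.Faithful.of_iso i.symm
  preserves :=
    have := h.preserves
    ⟨fun _ _ _ => preservesColimitsOfShape_of_natIso i.symm⟩
  coherent := h.coherent.of_iso F i
  concreteMonos := h.concreteMonos.of_iso F i

/-- The restriction of a relation symbol along a functor. -/
def RelSymbol.restrict {n : ℕ} (R : RelSymbol U n) : RelSymbol V n where
  rel A := {a | (i.hom.app A ∘ a) ∈ R.rel (F.obj A)}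
  map_mem {A B} f a ha := by
    have h := R.map_mem (F.map f) _ ha
    rwa [show (U.map (F.map f) ∘ i.hom.app A ∘ a) = i.hom.app B ∘ V.map f ∘ a from
      funext fun k => (ConcreteCategory.congr_hom (i.hom.naturality f) (a k)).symm] at h
  mem_of_map {A B} f a ha := by
    refine R.mem_of_map (F.map f) _ ?_
    rwa [show (U.map (F.map f) ∘ i.hom.app A ∘ a) = i.hom.app B ∘ V.map f ∘ a from
      funext fun k => (ConcreteCategory.congr_hom (i.hom.naturality f) (a k)).symm]

-- Each symbol of `U` restricts to one of `V`, so a bijection respecting all symbols of `V` respects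
-- those of `U` after transport along `i`; the resulting isomorphism lifts by full faithfulness.
include F i in
theorem DetectsIsos.of_iso (h : DetectsIsos U fun _ => Set.univ) :
    DetectsIsos V fun _ => Set.univ := by
  intro A B f hf
  obtain ⟨fbar, hfbar⟩ := h
    (((i.app A).symm.toEquiv.trans f).trans (i.app B).toEquiv) fun n R _ a => by
      have := hf n (R.restrict F i) (Set.mem_univ _) (i.inv.app A ∘ a)
      have ha : i.hom.app A ∘ i.inv.app A ∘ a = a :=
        funext fun k => (i.app A).symm.toEquiv.symm_apply_apply (a k)
      change (i.hom.app A ∘ i.inv.app A ∘ a) ∈ R.rel _ ↔ _ at this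
      rw [ha] at this
      exact this
  refine ⟨F.preimageIso fbar, fun x => ?_⟩
  apply (i.app B).toEquiv.injective
  have := ConcreteCategory.congr_hom (i.hom.naturality (F.preimage fbar.hom)) x
  refine this.trans ?_
  change U.map (F.map (F.preimage fbar.hom)) _ = _
  rw [F.map_preimage, hfbar]
  exact congrArg (fun y => (i.app B).toEquiv (f y)) ((i.app A).toEquiv.symm_apply_apply x)

include F i in
theorem IsoFull.of_iso {hU : ConcreteMonos U} (hV : ConcreteMonos V) (h : IsoFull U hU) :
    IsoFull V hV :=
  (isoFull_iff hV).2 (((isoFull_iff hU).1 h).of_iso F i)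

end FullyFaithful

/-! ### Repleteness by relabelling underlying sets -/

section Repleteness

variable {K : Type (w + 1)} [Category.{w} K] {U : K ⥤ Type w}

theorem embIsoEquiv_eqToIso {S : FirstOrder.Language.{0, w + 1}} {X Y : Emb S} (h : X = Y)
    (x : X.carrier) : embIsoEquiv (eqToIso h) x = cast (congrArg Emb.carrier h) x := by
  subst h
  rfl

/-- A structure on `U B` agrees with the canonical one if it is isomorphic to a canonical structure
by a bijection underlying an isomorphism of `K`. -/
theorem E_obj_eq (hU : ConcreteMonos U) {A B : K} (str : (sig U).Structure (U.obj B))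
    (g : (E U hU).obj A ≅ ⟨U.obj B⟩) (m : A ≅ B)
    (hm : ∀ x : U.obj A, U.map m.hom x = embIsoEquiv g x) : (E U hU).obj B = ⟨U.obj B⟩ := by
  have h : structureOn U B = str := by
    refine FirstOrder.Language.Structure.ext (funext fun n => funext fun f => Empty.elim f)
      (funext fun n => funext fun R => funext fun a => propext ?_)
    have ha : U.map m.hom ∘ U.map m.inv ∘ a = a := funext fun k => by
      change (U.map m.inv ≫ U.map m.hom) (a k) = a k
      rw [← U.map_comp, m.inv_hom_id, U.map_id]
      rfl
    have h₁ : (U.map m.hom ∘ U.map m.inv ∘ a) ∈ RelSymbol.rel R B ↔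
        (U.map m.inv ∘ a) ∈ RelSymbol.rel R A :=
      ⟨RelSymbol.mem_of_map R m.hom _, RelSymbol.map_mem R m.hom _⟩
    have h₂ := FirstOrder.Language.Embedding.map_rel' g.hom R (U.map m.inv ∘ a)
    have h₃ : (FirstOrder.Language.Embedding.toEmbedding g.hom ∘ U.map m.inv ∘ a) = a :=
      (funext fun k => (hm _).symm).trans ha
    rw [ha] at h₁
    refine h₁.trans (h₂.symm.trans (iff_of_eq ?_))
    exact congrArg (str.RelMap R) h₃
  exact congrArg (@Emb.mk (sig U) (U.obj B)) h

end Repleteness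


section Relabel

variable {K : Type (w + 1)} [Category.{w} K] (U : K ⥤ Type w)

/-- Objects of `K` with a chosen relabelling of the underlying set. -/
structure Relabel : Type (w + 1) where
  obj : K
  carrier : Type w
  equiv : U.obj obj ≃ carrier

instance : Category.{w} (Relabel U) :=
  inferInstanceAs (Category.{w} (InducedCategory K Relabel.obj))

namespace Relabel

/-- The functor forgetting the relabelling. -/
abbrev forget : Relabel U ⥤ K := inducedFunctor Relabel.obj

instance : (forget U).Full := inferInstanceAs (inducedFunctor Relabel.obj).Full

instance : (forget U).Faithful := inferInstanceAs (inducedFunctor Relabel.obj).Faithful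

instance : (forget U).EssSurj := ⟨fun A => ⟨⟨A, U.obj A, Equiv.refl _⟩, ⟨Iso.refl A⟩⟩⟩

instance : (forget U).IsEquivalence where

/-- The underlying set of an object of `Relabel U`. -/
def underlying : Relabel U ⥤ Type w where
  obj A := A.carrier
  map {A B} f := A.equiv.toIso.inv ≫ U.map f.hom ≫ B.equiv.toIso.hom
  map_id A := by
    rw [show InducedCategory.Hom.hom (𝟙 A) = 𝟙 A.obj from rfl, U.map_id, Category.id_comp,
      Iso.inv_hom_id]
  map_comp f g := by
    rw [show InducedCategory.Hom.hom (f ≫ g) = f.hom ≫ g.hom from rfl]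
    simp

/-- The relabelling as a natural isomorphism. -/
def underlyingIso : underlying U ≅ forget U ⋙ U :=
  NatIso.ofComponents (fun A => A.equiv.toIso.symm) fun f => by
    simp only [underlying, Iso.symm_hom, Category.assoc, Functor.comp_map]
    rw [Iso.hom_inv_id]
    exact congrArg _ (Category.comp_id _)

variable {U}

theorem isAcc2 (h : IsAcc2 U) : IsAcc2 (underlying U) :=
  have := h.accessible
  have := h.hasDirectedColimits
  have hL : IsAcc0.{w} (Relabel U) :=
    { accessible := (forget U).asEquivalence.symm.isAccessibleCategory
      hasDirectedColimits := ⟨fun _ _ _ =>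
        Adjunction.hasColimitsOfShape_of_equivalence (forget U)⟩ }
  have : PreservesFilteredColimitsOfSize.{w, w} (forget U) := ⟨fun _ _ _ => inferInstance⟩
  h.of_iso (forget U) (underlyingIso U) hL

theorem isReplete (hU : ConcreteMonos (underlying U)) : IsReplete (underlying U) hU := by
  rintro A ⟨X⟩ ⟨g⟩
  -- The object of `K` is unchanged and its labels are moved along `g`, so that the identity of
  -- `A.obj` has underlying map `g`.
  let B : Relabel U := ⟨A.obj, X, A.equiv.trans (embIsoEquiv g)⟩
  let m : A ≅ B := InducedCategory.isoMk (Iso.refl A.obj)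
  refine ⟨B, ⟨m⟩, E_obj_eq hU (A := A) (B := B) _ g m fun (x : A.carrier) => ?_⟩
  change embIsoEquiv g (A.equiv (U.map (𝟙 A.obj) (A.equiv.symm x))) = _
  rw [U.map_id]
  exact congrArg _ (A.equiv.apply_symm_apply x)

theorem isAEC (h : IsAcc2 U) (hiso : IsoFull U h.concreteMonos) : IsAEC (underlying U) where
  toIsAcc2 := isAcc2 h
  isoFull := hiso.of_iso (forget U) (underlyingIso U) _
  replete := isReplete _

end Relabel

variable {U} in
/-- An iso-full object of `Acc₂` is concretely equivalent to an abstract elementary class. -/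
theorem IsAcc2.isConcretelyEquivAEC (h : IsAcc2 U) (hiso : IsoFull U h.concreteMonos) :
    IsConcretelyEquivAEC U :=
  let e := (Relabel.forget U).asEquivalence
  ⟨Relabel U, inferInstance, Relabel.underlying U, e.symm, Relabel.isAEC h hiso,
    ⟨Functor.isoWhiskerLeft e.inverse (Relabel.underlyingIso U) ≪≫
      (Functor.associator _ _ _).symm ≪≫ Functor.isoWhiskerRight e.counitIso U ≪≫
      Functor.leftUnitor U⟩⟩

end Relabel

/-! ### Sieves closed under filtered colimits -/

section Sieve

variable {K : Type (w + 1)} [Category.{w} K] (P : ObjectProperty K)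

/-- A class of objects closed under filtered colimits, and under the domains of morphisms into its
members. -/
structure IsFilteredSieve : Prop where
  of_hom : ∀ {A B : K}, (A ⟶ B) → P B → P A
  closed : ∀ (J : Type w) [SmallCategory J] [IsFiltered J], P.IsClosedUnderColimitsOfShape J

variable {P} (hP : IsFilteredSieve P)

include hP

theorem IsFilteredSieve.inverseImage {L : Type (w + 1)} [Category.{w} L] (F : L ⥤ K)
    [PreservesFilteredColimitsOfSize.{w, w} F] : IsFilteredSieve (P.inverseImage F) where
  of_hom f h := hP.of_hom (F.map f) h
  closed J _ _ := have := hP.closed J; inferInstance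

theorem IsFilteredSieve.isClosedUnderIsomorphisms : P.IsClosedUnderIsomorphisms :=
  ⟨fun e h => hP.of_hom e.inv h⟩

theorem IsFilteredSieve.hasFilteredColimits [HasFilteredColimitsOfSize.{w, w} K] :
    HasFilteredColimitsOfSize.{w, w} P.FullSubcategory :=
  ⟨fun J _ _ => have := hP.closed J; inferInstance⟩

theorem IsFilteredSieve.preserves_ι [HasFilteredColimitsOfSize.{w, w} K] :
    PreservesFilteredColimitsOfSize.{w, w} P.ι :=
  ⟨fun J _ _ => have := hP.closed J; inferInstance⟩

/-- Morphisms out of `A` are morphisms out of `A.obj` in `K`, and the inclusion preserves filtered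
colimits. -/
theorem IsFilteredSieve.isCardinalPresentable [HasFilteredColimitsOfSize.{w, w} K]
    {κ : Cardinal.{w}} [Fact κ.IsRegular] (A : P.FullSubcategory)
    (hA : IsCardinalPresentable A.obj κ) : IsCardinalPresentable A κ := by
  have := hP.preserves_ι
  have : P.ι.IsCardinalAccessible κ := ⟨fun J _ _ => by
    have := isFiltered_of_isCardinalFiltered J κ
    infer_instance⟩
  exact Functor.isCardinalAccessible_of_natIso
    (F := P.ι ⋙ coyoneda.obj (Opposite.op A.obj)) (G := coyoneda.obj (Opposite.op A))
    (NatIso.ofComponents fun B =>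
      (Equiv.toIso (P.fullyFaithfulι.homEquiv (X := A) (Y := B))).symm) κ

/-- The index `κ` is kept: in a presentation of an object of `P` as a colimit of generators, every
generator maps to that object and so lies in the sieve. -/
theorem IsFilteredSieve.isAcc0 (h : IsAcc0.{w} K) : IsAcc0.{w} P.FullSubcategory := by
  have := h.hasDirectedColimits
  have := hP.hasFilteredColimits
  obtain ⟨κ, hκ, _⟩ := h.accessible.exists_cardinal
  obtain ⟨Q, _, hQ⟩ := HasCardinalFilteredGenerator.exists_small_generator K κ
  have : ObjectProperty.Small.{w} (Q.inverseImage P.ι) :=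
    small_of_injective (f := fun A : Subtype (Q.inverseImage P.ι) =>
      (⟨A.1.obj, A.2⟩ : Subtype Q)) fun A B hAB =>
        Subtype.ext (ObjectProperty.FullSubcategory.ext (congrArg Subtype.val hAB))
  have hgen : (Q.inverseImage P.ι).IsCardinalFilteredGenerator κ :=
    { le_isCardinalPresentable := fun A hA =>
        hP.isCardinalPresentable A (hQ.le_isCardinalPresentable _ hA)
      exists_colimitsOfShape := fun A => by
        obtain ⟨J, _, _, ⟨p⟩⟩ := hQ.exists_colimitsOfShape A.obj
        let D : J ⥤ P.FullSubcategory := P.lift p.diag fun j => hP.of_hom (p.ι.app j) A.property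
        let c : Cocone D :=
          { pt := A
            ι :=
              { app := fun j => ObjectProperty.homMk (p.ι.app j)
                naturality := fun j k f => ObjectProperty.hom_ext _ (p.ι.naturality f) } }
        exact ⟨J, inferInstance, inferInstance,
          ⟨{ diag := D
             ι := c.ι
             isColimit := isColimitOfReflects P.ι (show IsColimit (P.ι.mapCocone c) from p.isColimit)
             prop_diag_obj := p.prop_diag_obj }⟩⟩ }
  have := hgen.hasCardinalFilteredGenerator
  have : IsCardinalAccessibleCategory P.FullSubcategory κ :=
    { toHasCardinalFilteredColimits := ⟨fun J _ _ => by
        have := isFiltered_of_isCardinalFiltered J κ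
        infer_instance⟩ }
  exact ⟨⟨κ, hκ, this⟩, inferInstance⟩

variable {U : K ⥤ Type w}

theorem IsFilteredSieve.isAcc2 (h : IsAcc2 U) : IsAcc2 (P.ι ⋙ U) :=
  have := h.hasDirectedColimits
  have := hP.preserves_ι
  h.of_iso P.ι (Iso.refl _) (hP.isAcc0 h.toIsAcc0)

theorem IsFilteredSieve.isReplete {hU : ConcreteMonos U} (hiso : IsoFull U hU)
    (h : IsReplete U hU) (hPU : ConcreteMonos (P.ι ⋙ U)) : IsReplete (P.ι ⋙ U) hPU := by
  rintro A ⟨X⟩ ⟨g⟩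
  rename_i str
  -- Symbols of `U` are interpreted on `X` through their restrictions to `P`, which brings
  -- repleteness of `U` into play.
  let str' : (sig U).Structure X :=
    { funMap := fun f => Empty.elim f
      RelMap := fun {n} R a => str.RelMap (show (sig (P.ι ⋙ U)).Relations n from
        RelSymbol.restrict (U := U) P.ι (Iso.refl _) R) a }
  let e : U.obj A.obj ≃ X := embIsoEquiv g
  let g' : (E U hU).obj A.obj ≅ @Emb.mk _ X str' := embIsoMk e fun n R a =>
    (FirstOrder.Language.Embedding.map_rel' g.hom
      (RelSymbol.restrict (U := U) P.ι (Iso.refl (P.ι ⋙ U)) R) a).symm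
  obtain ⟨B, -, hB⟩ := h A.obj (@Emb.mk _ X str') ⟨g'⟩
  -- Repleteness gives only some isomorphism with `B`; iso-fullness gives one over `g`. It puts `B`
  -- in the sieve and lets `E_obj_eq` treat every symbol of `P.ι ⋙ U`, not just restricted ones.
  obtain ⟨m, hm⟩ := hiso (g' ≪≫ eqToIso hB.symm)
  have hX : X = U.obj B := (congrArg Emb.carrier hB).symm
  subst hX
  let B' : P.FullSubcategory := ⟨B, hP.of_hom m.inv A.property⟩
  refine ⟨B', ⟨P.isoMk m⟩, E_obj_eq hPU (A := A) (B := B') _ g (P.isoMk m) fun x => ?_⟩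
  refine (congrArg (fun k => embIsoEquiv k x) hm).trans ?_
  exact embIsoEquiv_eqToIso hB.symm (embIsoEquiv g' x)

theorem IsFilteredSieve.isAEC (h : IsAEC U) : IsAEC (P.ι ⋙ U) where
  toIsAcc2 := hP.isAcc2 h.toIsAcc2
  isoFull := h.isoFull.of_iso P.ι (Iso.refl _) _
  replete := hP.isReplete h.isoFull h.replete _

/-- The sieve is pulled back to the equivalent AEC, where it cuts out an AEC by
`IsFilteredSieve.isAEC`. -/
theorem IsFilteredSieve.isAcc3 (h : IsAcc3 U) : IsAcc3 (P.ι ⋙ U) where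
  toIsAcc2 := hP.isAcc2 h.toIsAcc2
  equivAEC := by
    obtain ⟨L, _, V, hV, ⟨e⟩⟩ := h.equivAEC
    have := hP.isClosedUnderIsomorphisms
    have : PreservesFilteredColimitsOfSize.{w, w} e.inverse := ⟨fun _ _ _ => inferInstance⟩
    exact ⟨(P.inverseImage e.inverse).FullSubcategory, inferInstance, _,
      (hP.inverseImage e.inverse).isAEC hV, ⟨(e.symm.congrFullSubcategory rfl).symm⟩⟩

end Sieve

/-! ### The equifier as a sieve -/

section Equifier

variable {K L : Type (w + 1)} [Category.{w} K] [Category.{w} L] {F G : K ⥤ L} (φ ψ : F ⟶ G)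

/-- For `f : A ⟶ B` with `φ` and `ψ` equal at `B`, naturality equates the components at `A` after
composing with the mono `G f`. At a colimit, they agree on the coprojections, which are jointly epic
after applying `F`. -/
theorem isFilteredSieve_eqProp (hL : ∀ ⦃A B : L⦄ (f : A ⟶ B), Mono f)
    [PreservesFilteredColimitsOfSize.{w, w} F] : IsFilteredSieve (eqProp φ ψ) where
  of_hom {A B} f hB := by
    have := hL (G.map f)
    rw [eqProp, ← cancel_mono (G.map f), ← φ.naturality, ← ψ.naturality, hB]
  closed J _ _ :=
    { colimitsOfShape_le := fun A ⟨p⟩ => by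
        refine (isColimitOfPreserves F p.isColimit).hom_ext fun j => ?_
        have h₁ := φ.naturality (p.ι.app j)
        have h₂ := ψ.naturality (p.ι.app j)
        rw [p.prop_diag_obj j, ← h₂] at h₁
        exact h₁ }

variable {φ ψ}

theorem whiskerLeft_ι_eqProp :
    Functor.whiskerLeft (eqProp φ ψ).ι φ = Functor.whiskerLeft (eqProp φ ψ).ι ψ :=
  NatTrans.ext (funext fun A => A.property)

end Equifier

/-! ### Strict uniqueness of lifts to full subcategories -/

section FullSubcategory

variable {K X : Type*} [Category* K] [Category* X] {P : ObjectProperty K}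

theorem comp_ι_injective {H H' : X ⥤ P.FullSubcategory} (h : H ⋙ P.ι = H' ⋙ P.ι) : H = H' := by
  refine Functor.hext (fun A => ObjectProperty.FullSubcategory.ext (Functor.congr_obj h A))
    fun A B f => ?_
  have hobj (A : X) : H.obj A = H'.obj A :=
    ObjectProperty.FullSubcategory.ext (Functor.congr_obj h A)
  have hmap := Functor.hcongr_hom h f
  have key : ∀ {A₁ B₁ A₂ B₂ : P.FullSubcategory} (f₁ : A₁ ⟶ B₁) (f₂ : A₂ ⟶ B₂), A₁ = A₂ →
      B₁ = B₂ → HEq (P.ι.map f₁) (P.ι.map f₂) → HEq f₁ f₂ := by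
    rintro A₁ B₁ _ _ f₁ f₂ rfl rfl hf
    exact heq_of_eq (P.ι.map_injective (eq_of_heq hf))
  exact key _ _ (hobj A) (hobj B) hmap

theorem existsUnique_whiskerRight_ι {H H' : X ⥤ P.FullSubcategory} (α : H ⋙ P.ι ⟶ H' ⋙ P.ι) :
    ∃! β : H ⟶ H', Functor.whiskerRight β P.ι = α :=
  ((P.fullyFaithfulι.whiskeringRight X).map_bijective H H').existsUnique α

end FullSubcategory

/-- The `U i` need not be iso-full, so the AEC is built from the product of the equivalent AECs `L
i`, whose coproduct functor is iso-full. -/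
theorem IsAcc3.coprodU {I : Type w} {K : I → Type (w + 1)} [∀ i, Category.{w} (K i)]
    {U : ∀ i, K i ⥤ Type w} (h : ∀ i, IsAcc3 (U i)) : IsAcc3 (AECat.coprodU U) where
  toIsAcc2 := .coprodU fun i => (h i).toIsAcc2
  equivAEC := by
    choose L _ V hV e using fun i => (h i).equivAEC
    obtain ⟨M, _, W, e', hW, -⟩ := (IsAcc2.coprodU fun i => (hV i).toIsAcc2).isConcretelyEquivAEC
      (isoFull_coprodU _ fun i => (hV i).isoFull)
    exact ⟨M, inferInstance, W, hW, ⟨(Equivalence.pi fun i => (e i).some).trans e'⟩⟩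

/-! ### Universal properties in the three 2-categories -/

section Products

variable {I : Type w} {K : I → Type (w + 1)} [∀ i, Category.{w} (K i)]

/-- The predicate `M` stands for the condition on 1-cells, which differs among the three
2-categories. -/
theorem existsUnique_comp_eval {H : Type*} [Category* H] (Q : ∀ i, H ⥤ K i)
    {M : (H ⥤ ∀ i, K i) → Prop} (hM : M (Functor.pi' Q)) :
    ∃! Qbar : H ⥤ ∀ i, K i, M Qbar ∧ ∀ i, Qbar ⋙ Pi.eval K i = Q i :=
  ⟨Functor.pi' Q, ⟨hM, fun _ => rfl⟩, fun _ hR => Functor.pi_ext _ _ hR.2⟩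

theorem existsUnique_whiskerRight_eval {H : Type*} [Category* H] {Q Q' : H ⥤ ∀ i, K i}
    (α : ∀ i, Q ⋙ Pi.eval K i ⟶ Q' ⋙ Pi.eval K i) :
    ∃! β : Q ⟶ Q', ∀ i, Functor.whiskerRight β (Pi.eval K i) = α i :=
  ⟨NatTrans.pi' α, fun _ => rfl, fun _ hβ => NatTrans.ext <| funext fun A => funext fun i =>
    NatTrans.congr_app (hβ i) A⟩

end Products

section Equifiers

variable {K L X : Type*} [Category* K] [Category* L] [Category* X] {P : ObjectProperty K}

theorem existsUnique_comp_ι (H : X ⥤ K) (hH : ∀ A, P (H.obj A))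
    {M : (X ⥤ P.FullSubcategory) → Prop} (hM : M (P.lift H hH)) :
    ∃! Hbar : X ⥤ P.FullSubcategory, M Hbar ∧ Hbar ⋙ P.ι = H :=
  ⟨P.lift H hH, ⟨hM, rfl⟩, fun _ hR => comp_ι_injective hR.2⟩

/-- The fully faithful inclusion reflects colimits. -/
theorem preservesFilteredColimits_lift (H : X ⥤ K) (hH : ∀ A, P (H.obj A))
    [_h : PreservesFilteredColimitsOfSize.{w, w} H] :
    PreservesFilteredColimitsOfSize.{w, w} (P.lift H hH) :=
  ⟨fun J _ _ =>
    have : PreservesColimitsOfShape J (P.lift H hH ⋙ P.ι) :=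
      inferInstanceAs (PreservesColimitsOfShape J H)
    preservesColimitsOfShape_of_reflects_of_preserves _ P.ι⟩

theorem isAccessible_lift (H : X ⥤ K) (hH : ∀ A, P (H.obj A)) [h : Functor.IsAccessible.{w} H] :
    Functor.IsAccessible.{w} (P.lift H hH) := by
  obtain ⟨κ, hκ, hH'⟩ := h.exists_cardinal
  refine ⟨κ, hκ, ⟨fun J _ _ => ?_⟩⟩
  have : PreservesColimitsOfShape J (P.lift H hH ⋙ P.ι) :=
    H.preservesColimitsOfShape_of_isCardinalAccessible κ J
  exact preservesColimitsOfShape_of_reflects_of_preserves _ P.ι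

end Equifiers

theorem isProduct_cat {I : Type w} (K : I → Acc3Obj.{w})
    (h : IsAcc3 (coprodU fun i => (K i).U)) :
    CATTwoCat.IsProduct (fun i => (K i).toCAT) (prodObj K h).toCAT
      (fun i => Pi.eval (fun i => (K i).carrier) i) where
  isMor _ := trivial
  lift _ Q _ := existsUnique_comp_eval (K := fun i => (K i).carrier) Q (M := fun _ => True) trivial
  lift₂ _ _ _ _ _ α := existsUnique_whiskerRight_eval (K := fun i => (K i).carrier) α

theorem isProduct_acc {I : Type w} (K : I → Acc3Obj.{w})
    (h : IsAcc3 (coprodU fun i => (K i).U)) :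
    AccTwoCat.IsProduct (fun i => (K i).toAcc) (prodObj K h).toAcc
      (fun i => Pi.eval (fun i => (K i).carrier) i) where
  isMor i :=
    have (i : I) := (K i).isAcc3.hasDirectedColimits
    have := preservesFilteredColimits_eval (K := fun i => (K i).carrier) i
    isAccessible_of_preservesFilteredColimits (Pi.eval (fun i => (K i).carrier) i)
  lift _ Q hQ := existsUnique_comp_eval (K := fun i => (K i).carrier) Q
    (M := fun Q => Functor.IsAccessible.{w} Q)
    (isAccessible_of_comp_eval (K := fun i => (K i).carrier) _ hQ)
  lift₂ _ _ _ _ _ α := existsUnique_whiskerRight_eval (K := fun i => (K i).carrier) α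

theorem isProduct_acc3 {I : Type w} (K : I → Acc3Obj.{w})
    (h : IsAcc3 (coprodU fun i => (K i).U)) :
    Acc3TwoCat.IsProduct K (prodObj K h) (fun i => Pi.eval (fun i => (K i).carrier) i) where
  isMor i :=
    have (i : I) := (K i).isAcc3.hasDirectedColimits
    preservesFilteredColimits_eval (K := fun i => (K i).carrier) i
  lift _ Q hQ := existsUnique_comp_eval (K := fun i => (K i).carrier) Q
    (M := fun Q => PreservesFilteredColimitsOfSize.{w, w} Q)
    (preservesFilteredColimits_of_comp_eval (K := fun i => (K i).carrier) _ hQ)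
  lift₂ _ _ _ _ _ α := existsUnique_whiskerRight_eval (K := fun i => (K i).carrier) α

section

variable {K L : Acc3Obj.{w}} {F G : K.carrier ⥤ L.carrier} (φ ψ : F ⟶ G)
  (h : IsAcc3 ((eqProp φ ψ).ι ⋙ K.U))

theorem isEquifier_cat :
    CATTwoCat.IsEquifier (K := K.toCAT) (L := L.toCAT) φ ψ (eqObj φ ψ h).toCAT (eqProp φ ψ).ι where
  isMor := trivial
  equifies := whiskerLeft_ι_eqProp
  lift _ H _ hH := existsUnique_comp_ι (P := eqProp φ ψ) H (fun A => NatTrans.congr_app hH A)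
    (M := fun _ => True) trivial
  lift₂ _ _ _ _ _ α := existsUnique_whiskerRight_ι (P := eqProp φ ψ) α

theorem isEquifier_acc (hP : IsFilteredSieve (eqProp φ ψ)) :
    AccTwoCat.IsEquifier (K := K.toAcc) (L := L.toAcc) φ ψ (eqObj φ ψ h).toAcc (eqProp φ ψ).ι where
  isMor :=
    have := K.isAcc3.hasDirectedColimits
    have := hP.preserves_ι
    isAccessible_of_preservesFilteredColimits (eqProp φ ψ).ι
  equifies := whiskerLeft_ι_eqProp
  lift _ H hacc hH := existsUnique_comp_ι (P := eqProp φ ψ) H (fun A => NatTrans.congr_app hH A)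
    (M := fun H => Functor.IsAccessible.{w} H)
    (isAccessible_lift (P := eqProp φ ψ) H (fun A => NatTrans.congr_app hH A) (h := hacc))
  lift₂ _ _ _ _ _ α := existsUnique_whiskerRight_ι (P := eqProp φ ψ) α

theorem isEquifier_acc3 (hP : IsFilteredSieve (eqProp φ ψ)) :
    Acc3TwoCat.IsEquifier (K := K) (L := L) φ ψ (eqObj φ ψ h) (eqProp φ ψ).ι where
  isMor :=
    have := K.isAcc3.hasDirectedColimits
    hP.preserves_ι
  equifies := whiskerLeft_ι_eqProp
  lift _ H hpres hH := existsUnique_comp_ι (P := eqProp φ ψ) H (fun A => NatTrans.congr_app hH A)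
    (M := fun H => PreservesFilteredColimitsOfSize.{w, w} H)
    (preservesFilteredColimits_lift (P := eqProp φ ψ) H (fun A => NatTrans.congr_app hH A)
      (_h := hpres))
  lift₂ _ _ _ _ _ α := existsUnique_whiskerRight_ι (P := eqProp φ ψ) α

end

end AECat

theorem proposition2p7 :
    (∀ (I : Type w) (K : I → Acc3Obj.{w}),
      ∃ h : IsAcc3 (coprodU fun i => (K i).U),
        CATTwoCat.IsProduct (fun i => (K i).toCAT) (prodObj K h).toCAT
          (fun i => Pi.eval (fun i => (K i).carrier) i) ∧
        AccTwoCat.IsProduct (fun i => (K i).toAcc) (prodObj K h).toAcc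
          (fun i => Pi.eval (fun i => (K i).carrier) i) ∧
        Acc3TwoCat.IsProduct K (prodObj K h) (fun i => Pi.eval (fun i => (K i).carrier) i) ∧
        ((∀ i, IsoFull (K i).U (K i).isAcc3.concreteMonos) →
          DetectsIsos (coprodU fun i => (K i).U) (coprodSymbols fun i => (K i).U) ∧
          IsoFull (coprodU fun i => (K i).U) h.concreteMonos ∧
          IsConcretelyEquivAEC (coprodU fun i => (K i).U))) ∧
    (∀ (K L : Acc3Obj.{w}) (F G : K.carrier ⥤ L.carrier),
      Acc3TwoCat.IsMor (X := K) (Y := L) F → Acc3TwoCat.IsMor (X := K) (Y := L) G →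
      ∀ φ ψ : F ⟶ G,
      ∃ h : IsAcc3 ((eqProp φ ψ).ι ⋙ K.U),
        CATTwoCat.IsEquifier (K := K.toCAT) (L := L.toCAT) φ ψ (eqObj φ ψ h).toCAT (eqProp φ ψ).ι ∧
        AccTwoCat.IsEquifier (K := K.toAcc) (L := L.toAcc) φ ψ (eqObj φ ψ h).toAcc (eqProp φ ψ).ι ∧
        Acc3TwoCat.IsEquifier (K := K) (L := L) φ ψ (eqObj φ ψ h) (eqProp φ ψ).ι ∧
        (IsoFull K.U K.isAcc3.concreteMonos →
          IsoFull ((eqProp φ ψ).ι ⋙ K.U) h.concreteMonos) ∧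
        (IsAEC K.U → IsAEC ((eqProp φ ψ).ι ⋙ K.U))) := by
  refine ⟨fun I K => ?_, fun K L F G hF _ φ ψ => ?_⟩
  · have h := IsAcc3.coprodU fun i => (K i).isAcc3
    refine ⟨h, isProduct_cat K h, isProduct_acc K h, isProduct_acc3 K h, fun hiso => ?_⟩
    have hfull := isoFull_coprodU _ hiso
    exact ⟨detectsIsos_coprodSymbols fun i => (isoFull_iff _).1 (hiso i), hfull,
      h.isConcretelyEquivAEC hfull⟩
  · have : PreservesFilteredColimitsOfSize.{w, w} F := hF
    have hP := isFilteredSieve_eqProp φ ψ L.isAcc3.concreteMonos.mono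
    have h := hP.isAcc3 K.isAcc3
    exact ⟨h, isEquifier_cat φ ψ h, isEquifier_acc φ ψ h hP, isEquifier_acc3 φ ψ h hP,
      fun hiso => hiso.of_iso (eqProp φ ψ).ι (Iso.refl _) _, hP.isAEC⟩
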